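/- Let $R$ be a commutative ring with $1$, let $A$ be a unital associative $R$-algebra, and let $n\ge 2$ be an integer. For an $R$-algebra $\mathcal B$ and a positive integer $k$, call $\mathcal B$ $k$-torsion free if $kx=0$ implies $x=0$ for all $x\in\mathcal B$. Put $[x,y]=xy-yx$, $p_1(x_1)=x_1$ and $p_m(x_1,\dots,x_m)=[p_{m-1}(x_1,\dots,x_{m-1}),x_m]$ for $m\ge 2$; the elements $p_n(x_1,\dots,x_n)$ of $\mathcal B$ are its $(n-1)$-th commutators. An $R$-linear map $\varphi:\mathcal B\to\mathcal B$ is a Lie $n$-derivation if $$\varphi(p_n(x_1,\dots,x_n))=\sum_{i=1}^{n}p_n(x_1,\dots,x_{i-1},\varphi(x_i),x_{i+1},\dots,x_n)$$ for all $x_1,\dots,x_n\in\mathcal B$. It is standard if $\varphi=h+\tau$, where $h:\mathcal B\to\mathcal B$ is an $R$-linear derivation (that is, $h(xy)=h(x)y+xh(y)$ for all $x,y\in\mathcal B$) and $\tau$ is an $R$-linear map from $\mathcal B$ into its centre that vanishes on all $(n-1)$-th commutators of $\mathcal B$. (a) If $s\ge 3$ and the full matrix algebra $M_s(A)$ is $2$-torsion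 free and $(n-1)$-torsion free, then every Lie $n$-derivation on $M_s(A)$ is standard. (b) If $M_2(A)$ is $2$-torsion free and $(n-1)$-torsion free, and $A$ is either commutative, or noncommutative and prime (that is, $A\ne 0$, and $aAb=\{0\}$ implies $a=0$ or $b=0$), then every Lie $n$-derivation on $M_2(A)$ is standard. -/

import Mathlib

/-- The polynomials `p_n`: `p_1(x_1) = x_1` and
`p_n(x_1, …, x_n) = [p_{n-1}(x_1, …, x_{n-1}), x_n]` for `n ≥ 2`, where `[x, y] = xy - yx`.
The value for `n = 0` is a convention that is never used. -/
def lieP {B : Type*} [Ring B] : (n : ℕ) → (Fin n → B) → B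
  | 0, _ => 0
  | 1, x => x 0
  | n + 2, x =>
      lieP (n + 1) (fun i => x i.castSucc) * x (Fin.last (n + 1)) -
        x (Fin.last (n + 1)) * lieP (n + 1) (fun i => x i.castSucc)

/-- `B` is `k`-torsion free: `k x = 0` implies `x = 0`. -/
def IsNTorsionFree (k : ℕ) (B : Type*) [Ring B] : Prop :=
  ∀ x : B, k • x = 0 → x = 0

/-- A linear map `h` on the algebra `B` is a derivation. -/
def IsAlgDerivation {R B : Type*} [CommRing R] [Ring B] [Algebra R B] (h : B →ₗ[R] B) : Prop :=
  ∀ x y : B, h (x * y) = h x * y + x * h y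

/-- A linear map `φ` on the algebra `B` is a Lie `n`-derivation (a notion for `n ≥ 2`). -/
def IsLieNDerivation {R B : Type*} [CommRing R] [Ring B] [Algebra R B]
    (n : ℕ) (φ : B →ₗ[R] B) : Prop :=
  ∀ x : Fin n → B,
    φ (lieP n x) = ∑ i : Fin n, lieP n (Function.update x i (φ (x i)))

/-- `φ` is the sum of a derivation and a linear map into the centre that vanishes on all
`(n-1)`-th commutators `p_n(x_1, …, x_n)`. -/
def IsStandard {R B : Type*} [CommRing R] [Ring B] [Algebra R B]
    (n : ℕ) (φ : B →ₗ[R] B) : Prop :=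
  ∃ h τ : B →ₗ[R] B, φ = h + τ ∧ IsAlgDerivation h ∧
    (∀ x : B, τ x ∈ Subalgebra.center R B) ∧ (∀ x : Fin n → B, τ (lieP n x) = 0)

/-- Primeness in the sense of noncommutative rings: `a A b = 0` implies `a = 0` or `b = 0`,
and the ring is nonzero. -/
def IsPrimeAlg (A : Type*) [Ring A] : Prop :=
  Nontrivial A ∧ ∀ a b : A, (∀ x : A, a * x * b = 0) → a = 0 ∨ b = 0

/-! Let `e` be the matrix unit E₁₁, put f = 1 - e, and let `u` = E₁₂, `v` = E₂₁, so `u * v = e`. The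
argument runs in any ring with such a linked idempotent whose Peirce corners have enough centre
(`HasCentralCorners`); matrices enter only at the end.

Everything starts from p_n(x, f, …, f) = ad_e^(n-1)(x), where ad_e x = [e, x]. For x in eBf this
element is x itself, and comparing eBf-components in the Lie n-derivation identity, with
(n-1)-torsion freeness, shows that the diagonal part of φ(f) commutes with eBf, hence is central.
Subtracting an inner derivation removes the off-diagonal part (`exists_adLeft_central`). Once φ(f)
is central, ad_e³ = ad_e reduces the identity to small powers of ad_e: φ commutes with ad_e and
obeys the Leibniz rule for brackets with an off-diagonal element (`leibniz_adLeft`). From here on n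
plays almost no role.

Such a φ preserves eBf, fBe and the diagonal, but may mix the two diagonal corners. For a in eBe and
b in fBf, the element [φa, b] + [a, φb] is central (`defect_central`); the corner conditions then
force the wrong-corner components of φa and φb to come from central elements. These elements
assemble to a central map τ, and h = φ - τ preserves every Peirce component.

The bracket rules become product rules for h whenever one of the two products in the bracket
vanishes. The remaining products are reached by cancelling `u` or by faithfulness of eBf, except for
eBf·fBe, where τ could interfere; 2-torsion freeness excludes this (`map_bracket_uv`). So h is a
derivation, and τ kills p_n because p_n with a central entry is zero. -/

/-! ### Calculus of the Lie polynomials p_n -/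

section Tuples

variable {B : Type*} [Ring B]

/-- The right-hand side of the Lie `n`-derivation identity. -/
def lieSum (φ : B → B) (n : ℕ) (x : Fin n → B) : B :=
  ∑ i : Fin n, lieP n (Function.update x i (φ (x i)))

theorem lieP_snoc (n : ℕ) (x : Fin (n + 1) → B) (y : B) :
    lieP (n + 2) (Fin.snoc x y : Fin (n + 2) → B) = lieP (n + 1) x * y - y * lieP (n + 1) x := by
  simp [lieP]

theorem lieP_add_two (n : ℕ) (x : Fin (n + 2) → B) :
    lieP (n + 2) x = lieP (n + 1) (Fin.init x) * x (Fin.last _) -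
      x (Fin.last _) * lieP (n + 1) (Fin.init x) := rfl

theorem lieSum_snoc (φ : B → B) (n : ℕ) (x : Fin (n + 1) → B) (y : B) :
    lieSum φ (n + 2) (Fin.snoc x y : Fin (n + 2) → B) =
      (lieSum φ (n + 1) x * y - y * lieSum φ (n + 1) x) +
        (lieP (n + 1) x * φ y - φ y * lieP (n + 1) x) := by
  unfold lieSum
  rw [Fin.sum_univ_castSucc]
  congr 1
  · rw [Finset.sum_mul, Finset.mul_sum, ← Finset.sum_sub_distrib]
    refine Finset.sum_congr rfl fun i _ => ?_
    rw [Fin.snoc_castSucc (α := fun _ => B), ← Fin.snoc_update (α := fun _ => B), lieP_snoc]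
  · rw [Fin.snoc_last (α := fun _ => B), Fin.update_snoc_last (α := fun _ => B), lieP_snoc]

/-- The tuple `(x, g, …, g)` with `m` entries `g`. -/
def padTuple (g x : B) : (m : ℕ) → Fin (m + 1) → B
  | 0 => fun _ => x
  | m + 1 => Fin.snoc (padTuple g x m) g

/-- The inner derivation `x ↦ [e, x]`. -/
def adLeft (e x : B) : B := e * x - x * e

theorem lieP_padTuple (e x : B) (m : ℕ) :
    lieP (m + 1) (padTuple (1 - e) x m) = (adLeft e)^[m] x := by
  induction m with
  | zero => rfl
  | succ m ih =>
    rw [padTuple, lieP_snoc, ih, Function.iterate_succ_apply', adLeft]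
    noncomm_ring

theorem lieSum_padTuple_zero (φ : B → B) (g x : B) :
    lieSum φ 1 (padTuple g x 0) = φ x := by
  simp [lieSum, lieP, padTuple]

theorem lieSum_padTuple_succ (φ : B → B) (e x : B) (m : ℕ) :
    lieSum φ (m + 2) (padTuple (1 - e) x (m + 1)) =
      adLeft e (lieSum φ (m + 1) (padTuple (1 - e) x m)) +
        ((adLeft e)^[m] x * φ (1 - e) - φ (1 - e) * (adLeft e)^[m] x) := by
  rw [padTuple, lieSum_snoc, lieP_padTuple, adLeft]
  noncomm_ring

theorem lieSum_padTuple_of_central (φ : B → B) (e x : B) (hφ : ∀ y, y * φ (1 - e) = φ (1 - e) * y)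
    (m : ℕ) :
    lieSum φ (m + 1) (padTuple (1 - e) x m) = (adLeft e)^[m] (φ x) := by
  induction m with
  | zero => exact lieSum_padTuple_zero φ _ x
  | succ m ih =>
    rw [lieSum_padTuple_succ, ih, hφ, sub_self, add_zero, Function.iterate_succ_apply']

theorem lieP_eq_zero_of_central {c : B} (hc : ∀ y, y * c = c * y) :
    ∀ (n : ℕ) (x : Fin (n + 2) → B) (i : Fin (n + 2)), lieP (n + 2) (Function.update x i c) = 0
  | n, x, i => by
    induction i using Fin.lastCases with
    | last =>
      rw [lieP_add_two]
      simp [hc]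
    | cast i =>
      rw [lieP_add_two, Fin.init_update_castSucc]
      cases n with
      | zero =>
        have : i = 0 := Fin.fin_one_eq_zero i
        subst this
        simp [lieP, hc]
      | succ n => rw [lieP_eq_zero_of_central hc n]; simp

theorem lieSum_eq_of_derivation (h : B → B)
    (hh : ∀ x y : B, h (x * y) = h x * y + x * h y) (hs : ∀ x y : B, h (x - y) = h x - h y) :
    ∀ (n : ℕ) (x : Fin (n + 1) → B), h (lieP (n + 1) x) = lieSum h (n + 1) x
  | 0, x => by simp [lieSum, lieP]
  | n + 1, x => by
    rw [← Fin.snoc_init_self x, lieSum_snoc, ← lieSum_eq_of_derivation h hh hs n, lieP_snoc, hs,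
      hh, hh]
    noncomm_ring

theorem lieP_update_add (c d : B) :
    ∀ (n : ℕ) (x : Fin (n + 1) → B) (i : Fin (n + 1)),
      lieP (n + 1) (Function.update x i (c + d)) =
        lieP (n + 1) (Function.update x i c) + lieP (n + 1) (Function.update x i d)
  | 0, x, i => by
    have : i = 0 := Fin.fin_one_eq_zero i
    subst this
    simp [lieP]
  | n + 1, x, i => by
    induction i using Fin.lastCases with
    | last => simp only [lieP_add_two, Fin.init_update_last, Function.update_self]; noncomm_ring
    | cast i =>
      simp only [lieP_add_two, Fin.init_update_castSucc, lieP_update_add c d n,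
        Function.update_of_ne (Fin.castSucc_lt_last i).ne']
      noncomm_ring

theorem lieSum_add (φ ψ : B → B) (n : ℕ) (x : Fin (n + 1) → B) :
    lieSum (fun y => φ y + ψ y) (n + 1) x = lieSum φ (n + 1) x + lieSum ψ (n + 1) x := by
  simp only [lieSum, lieP_update_add, Finset.sum_add_distrib]

end Tuples

/-! ### Powers of ad_e and reduction to ordinary brackets -/

section Peirce

variable {B : Type*} [Ring B]

theorem adLeft_add (e x y : B) : adLeft e (x + y) = adLeft e x + adLeft e y := by
  simp only [adLeft]; noncomm_ring

theorem adLeft_sub (e x y : B) : adLeft e (x - y) = adLeft e x - adLeft e y := by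
  simp only [adLeft]; noncomm_ring

/-- ad_e acts as 1 on eBf, as -1 on fBe and as 0 on the diagonal corners. -/
theorem adLeft_cube {e : B} (he : e * e = e) (x : B) :
    adLeft e (adLeft e (adLeft e x)) = adLeft e x := by
  have he' : ∀ t, e * (e * t) = e * t := fun t => by rw [← mul_assoc, he]
  simp only [adLeft, mul_sub, sub_mul, mul_assoc, he, he']
  abel

theorem adLeft_iterate_two_mul {e : B} (he : e * e = e) (k : ℕ) (x : B) :
    (adLeft e)^[2 * k] (adLeft e x) = adLeft e x := by
  induction k with
  | zero => rfl
  | succ k ih => rw [mul_add, mul_one, Function.iterate_add_apply]; simp [adLeft_cube he, ih]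

theorem adLeft_iterate_odd {e : B} (he : e * e = e) (k : ℕ) (x : B) :
    (adLeft e)^[2 * k + 1] x = adLeft e x := by
  rw [Function.iterate_succ_apply, adLeft_iterate_two_mul he]

theorem adLeft_of_upper {e x : B} (h1 : e * x = x) (h2 : x * e = 0) : adLeft e x = x := by
  simp [adLeft, h1, h2]

theorem adLeft_of_lower {e x : B} (h1 : e * x = 0) (h2 : x * e = x) : adLeft e x = -x := by
  simp [adLeft, h1, h2]

/-- ad_e² is the projection onto eBf + fBe, so an element it fixes has no diagonal part. -/
theorem corner_eq_zero_of_adLeft_sq {e w : B} (he : e * e = e) (h : adLeft e (adLeft e w) = w) :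
    e * w * e = 0 ∧ e * w + w * e = w := by
  have he' : ∀ t, e * (e * t) = e * t := fun t => by rw [← mul_assoc, he]
  simp only [adLeft, mul_sub, sub_mul, mul_assoc, he, he'] at h
  have h1 : e * (w * e) = 0 := by
    have h2 := congrArg (fun t => e * (t * e)) h
    simp only [mul_sub, sub_mul, mul_assoc, he, he'] at h2
    rw [← h2]; abel
  refine ⟨by rw [mul_assoc, h1], ?_⟩
  simpa [h1] using h

/-- If `φ` satisfies the Leibniz rule for Lie brackets against `adLeft e`, then it commutes with
`adLeft e`, provided that the idempotent `e` factors through its complement. -/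
theorem adLeft_comm_of_odd {e u v : B} (he : e * e = e) (hu : e * u = u) (hu' : u * e = 0)
    (hv : e * v = 0) (hv' : v * e = v) (huv : u * v = e)
    (h2 : ∀ x : B, 2 • x = 0 → x = 0) (φ : B →+ B)
    (hsq : ∀ x, φ (adLeft e (adLeft e x)) = adLeft e (adLeft e (φ x)))
    (hbr : ∀ x y, φ (adLeft e x * y - y * adLeft e x) =
      (adLeft e (φ x) * y - y * adLeft e (φ x)) + (adLeft e x * φ y - φ y * adLeft e x)) (x : B) :
    φ (adLeft e x) = adLeft e (φ x) := by
  have he' : ∀ t, e * (e * t) = e * t := fun t => by rw [← mul_assoc, he]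
  -- the two off-diagonal Peirce components
  have up : ∀ x, e * x = x → x * e = 0 → e * φ x = φ x ∧ φ x * e = 0 := by
    have key : ∀ x, e * x = x → x * e = 0 → e * φ x * e = 0 ∧ e * φ x + φ x * e = φ x := by
      intro x hx hx'
      apply corner_eq_zero_of_adLeft_sq he
      rw [← hsq, adLeft_of_upper hx hx', adLeft_of_upper hx hx']
    have anti : ∀ x y, e * x = x → x * e = 0 → e * y = y → y * e = 0 →
        φ x * y + φ y * x = 0 := by
      intro x y hx hx' hy hy'
      have hxy : x * y = 0 := by rw [← hy, ← mul_assoc, hx', zero_mul]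
      have hyx : y * x = 0 := by rw [← hx, ← mul_assoc, hy', zero_mul]
      have h := hbr x y
      rw [adLeft_of_upper hx hx', hxy, hyx, sub_zero, map_zero] at h
      have h3 : e * (φ x * y) = 0 := by
        rw [← hy, ← mul_assoc, ← mul_assoc, (key x hx hx').1, zero_mul]
      have h3' : e * (φ y * x) = 0 := by
        rw [← hx, ← mul_assoc, ← mul_assoc, (key y hy hy').1, zero_mul]
      have h4 := congrArg (fun t => (1 - e) * t) h
      have e1 : ∀ t, e * (x * t) = x * t := fun t => by rw [← mul_assoc, hx]
      have e2 : ∀ t, e * (y * t) = y * t := fun t => by rw [← mul_assoc, hy]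
      simp only [adLeft, mul_add, mul_sub, sub_mul, one_mul, mul_assoc, hy, mul_zero, h3, h3',
        e1, e2] at h4
      rw [← neg_eq_zero, h4]
      abel
    -- Taking x = y = u in `anti` gives 2φ(u)u = 0; right multiplication by `v` turns φ(u)u = 0 into
    -- φ(u)e = 0. Pairing a general x with `u` then transfers this to φ(x).
    have hφu : φ u * e = 0 := by
      have := anti u u hu hu' hu hu'
      rw [← two_nsmul] at this
      rw [← huv, ← mul_assoc, h2 _ this, zero_mul]
    intro x hx hx'
    have h5 : φ x * e = 0 := by
      have := anti x u hx hx' hu hu'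
      rw [← hx, ← mul_assoc (φ u), hφu, zero_mul, add_zero, hx] at this
      rw [← huv, ← mul_assoc, this, zero_mul]
    refine ⟨?_, h5⟩
    have := (key x hx hx').2
    rwa [h5, add_zero] at this
  have low : ∀ x, e * x = 0 → x * e = x → e * φ x = 0 ∧ φ x * e = φ x := by
    have key : ∀ x, e * x = 0 → x * e = x → e * φ x * e = 0 ∧ e * φ x + φ x * e = φ x := by
      intro x hx hx'
      apply corner_eq_zero_of_adLeft_sq he
      rw [← hsq, adLeft_of_lower hx hx']
      simp [adLeft, hx, hx']
    have anti : ∀ x y, e * x = 0 → x * e = x → e * y = 0 → y * e = y →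
        y * φ x + x * φ y = 0 := by
      intro x y hx hx' hy hy'
      have hxy : x * y = 0 := by rw [← hx', mul_assoc, hy, mul_zero]
      have hyx : y * x = 0 := by rw [← hy', mul_assoc, hx, mul_zero]
      have h := hbr x y
      rw [adLeft_of_lower hx hx', neg_mul, mul_neg, hxy, hyx, sub_self, map_zero] at h
      have h3 : y * (φ x * e) = 0 := by
        rw [← hy', mul_assoc, ← mul_assoc e, (key x hx hx').1, mul_zero]
      have h3' : x * (φ y * e) = 0 := by
        rw [← hx', mul_assoc, ← mul_assoc e, (key y hy hy').1, mul_zero]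
      have h4 := congrArg (fun t => t * (1 - e)) h
      have e1 : ∀ t, y * (e * t) = y * t := fun t => by rw [← mul_assoc, hy']
      simp only [adLeft, add_mul, mul_sub, sub_mul, mul_one, mul_assoc, neg_mul, mul_neg,
        hx', hy', zero_mul, e1, h3, h3'] at h4
      rw [← neg_eq_zero, ← sub_zero (0 : B), h4]
      abel
    have hφv : e * φ v = 0 := by
      have := anti v v hv hv' hv hv'
      rw [← two_nsmul] at this
      rw [← huv, mul_assoc, h2 _ this, mul_zero]
    intro x hx hx'
    have h5 : e * φ x = 0 := by
      have := anti x v hx hx' hv hv'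
      rw [← hx', mul_assoc x, hφv, mul_zero, add_zero, hx'] at this
      rw [← huv, mul_assoc, this, mul_zero]
    refine ⟨h5, ?_⟩
    have := (key x hx hx').2
    rwa [h5, zero_add] at this
  -- x - ad_e² x is the diagonal part of x, which ad_e kills.
  have hdiag : adLeft e (φ (x - adLeft e (adLeft e x))) = 0 := by
    rw [← adLeft_cube he, ← hsq]
    simp [adLeft_sub, adLeft_cube he]
    simp [adLeft]
  set p := e * x - e * x * e with hp
  set q := x * e - e * x * e with hq
  have hp1 : e * p = p := by simp only [hp, mul_sub, mul_assoc, he']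
  have hp2 : p * e = 0 := by simp only [hp, sub_mul, mul_assoc, he, sub_self]
  have hq1 : e * q = 0 := by simp only [hq, mul_sub, mul_assoc, he', sub_self]
  have hq2 : q * e = q := by simp only [hq, sub_mul, mul_assoc, he]
  have hx1 : adLeft e x = p - q := by simp only [adLeft, hp, hq]; abel
  have hx2 : adLeft e (adLeft e x) = p + q := by
    rw [hx1, adLeft_sub, adLeft_of_upper hp1 hp2, adLeft_of_lower hq1 hq2, sub_neg_eq_add]
  rw [hx2] at hdiag
  have : φ x = φ (x - (p + q)) + (φ p + φ q) := by rw [← map_add, ← map_add, sub_add_cancel]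
  rw [this, adLeft_add, hdiag, zero_add, adLeft_add, adLeft_of_upper (up p hp1 hp2).1 (up p hp1 hp2).2,
    adLeft_of_lower (low q hq1 hq2).1 (low q hq1 hq2).2, hx1, map_sub, sub_eq_add_neg]

/-- A map with the Lie `n`-derivation identity that sends `1 - e` to a central element commutes with
`adLeft e` and satisfies the Leibniz rule for brackets with elements `[e, x]`. -/
theorem leibniz_adLeft {e u v : B} (he : e * e = e) (hu : e * u = u) (hu' : u * e = 0)
    (hv : e * v = 0) (hv' : v * e = v) (huv : u * v = e)
    (h2 : ∀ x : B, 2 • x = 0 → x = 0) (φ : B →+ B) (m : ℕ)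
    (hφ : ∀ x, φ (lieP (m + 2) x) = lieSum φ (m + 2) x)
    (hc : ∀ y, y * φ (1 - e) = φ (1 - e) * y) :
    (∀ x, φ (adLeft e x) = adLeft e (φ x)) ∧
    ∀ x y, φ (adLeft e x * y - y * adLeft e x) =
      (φ (adLeft e x) * y - y * φ (adLeft e x)) + (adLeft e x * φ y - φ y * adLeft e x) := by
  have hP : ∀ x, φ ((adLeft e)^[m + 1] x) = (adLeft e)^[m + 1] (φ x) := by
    intro x
    rw [← lieP_padTuple, hφ, lieSum_padTuple_of_central (φ := φ) e x hc]
  have hE : ∀ x y, φ ((adLeft e)^[m] x * y - y * (adLeft e)^[m] x) =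
      ((adLeft e)^[m] (φ x) * y - y * (adLeft e)^[m] (φ x)) +
        ((adLeft e)^[m] x * φ y - φ y * (adLeft e)^[m] x) := by
    intro x y
    rw [← lieP_padTuple, ← lieP_snoc, hφ, lieSum_snoc, lieSum_padTuple_of_central (φ := φ) e x hc]
  -- For even m, ad_e^(m+1) = ad_e and commutation is immediate. For odd m only commutation with
  -- ad_e² is available, and the bracket identity must supply the sign.
  obtain ⟨k, rfl | rfl⟩ := m.even_or_odd'
  · simp only [adLeft_iterate_odd he] at hP
    refine ⟨hP, fun x y => ?_⟩
    have := hE (adLeft e x) y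
    rwa [hP, adLeft_iterate_two_mul he, adLeft_iterate_two_mul he, ← hP] at this
  · simp only [adLeft_iterate_odd he, Function.iterate_succ_apply'] at hP hE
    have := adLeft_comm_of_odd he hu hu' hv hv' huv h2 φ hP hE
    refine ⟨this, fun x y => ?_⟩
    rw [this, hE]

end Peirce

/-! ### Linked idempotents and normalisation of φ(1 - e) -/

/-- An idempotent `e` with a factorization `e = u * v` through its complement, such that
`e * B * (1 - e)` acts faithfully on the left of `(1 - e) * B`. -/
structure IsLinkedIdempotent {B : Type*} [Ring B] (e u v : B) : Prop where
  idem : e * e = e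
  left_u : e * u = u
  right_u : u * e = 0
  left_v : e * v = 0
  right_v : v * e = v
  mul_uv : u * v = e
  faithful : ∀ b : B, e * b = 0 → (∀ x, e * x = x → x * e = 0 → x * b = 0) → b = 0

namespace IsLinkedIdempotent

variable {B : Type*} [Ring B] {e u v : B}

/-- Commutation spreads from eBf to eBe by writing a = (au)v, hence to eB. For t in fB, every x in
eBf satisfies x[d, t] = [d, xt] = 0 because xt lies in eB, and faithfulness applies. -/
theorem central_of_commute (H : IsLinkedIdempotent e u v) {d : B} (hd : e * d = d * e)
    (hx : ∀ x, e * x = x → x * e = 0 → d * x = x * d) (y : B) : y * d = d * y := by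
  have h11 : ∀ a, e * a = a → a * e = a → d * a = a * d := by
    intro a ha ha'
    have h1 : d * (a * u) = a * u * d :=
      hx _ (by rw [← mul_assoc, ha]) (by rw [mul_assoc, H.right_u, mul_zero])
    calc d * a = d * (a * u) * v := by rw [mul_assoc, mul_assoc, H.mul_uv, ha']
      _ = a * (d * u) * v := by rw [h1, mul_assoc a, hx u H.left_u H.right_u]
      _ = a * e * d := by rw [mul_assoc, mul_assoc, H.mul_uv, ← hd, mul_assoc]
      _ = a * d := by rw [ha']
  have h1 : ∀ t, e * t = t → d * t = t * d := by
    intro t ht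
    have h2 := h11 (t * e) (by rw [← mul_assoc, ht]) (by rw [mul_assoc, H.idem])
    have h3 := hx (t - t * e) (by rw [mul_sub, ← mul_assoc, ht])
      (by rw [sub_mul, mul_assoc, H.idem, sub_self])
    rw [← add_sub_cancel (t * e) t, mul_add, add_mul, h2, h3]
  have h2 : ∀ t, e * t = 0 → d * t = t * d := by
    intro t ht
    rw [← sub_eq_zero]
    apply H.faithful
    · rw [mul_sub, ← mul_assoc, ← mul_assoc, hd, mul_assoc, ht]; simp
    · intro x hx1 hx2
      rw [mul_sub, ← mul_assoc, ← mul_assoc, ← hx x hx1 hx2, mul_assoc,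
        h1 (x * t) (by rw [← mul_assoc, hx1]), sub_self]
  rw [← add_sub_cancel (e * y) y, mul_add, add_mul, h1 (e * y) (by rw [← mul_assoc, H.idem]),
    h2 (y - e * y) (by rw [mul_sub, ← mul_assoc, H.idem, sub_self])]

theorem eq_zero_of_central (H : IsLinkedIdempotent e u v) {z : B} (hz : ∀ y, y * z = z * y)
    (h : e * z = 0) : z = 0 := by
  refine H.faithful z h fun x hx _ => ?_
  rw [hz, ← hx, ← mul_assoc, ← hz, h, zero_mul]

/-- After subtracting an inner derivation, a Lie `n`-derivation maps `1 - e` to the centre. -/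
theorem exists_adLeft_central (H : IsLinkedIdempotent e u v) (m : ℕ)
    (htf : ∀ x : B, (m + 1) • x = 0 → x = 0) (φ : B →+ B)
    (hφ : ∀ x, φ (lieP (m + 2) x) = lieSum φ (m + 2) x) :
    ∃ t, ∀ y, y * (φ (1 - e) - (t * (1 - e) - (1 - e) * t)) =
      (φ (1 - e) - (t * (1 - e) - (1 - e) * t)) * y := by
  have he' : ∀ t, e * (e * t) = e * t := fun t => by rw [← mul_assoc, H.idem]
  set w := φ (1 - e) with hw
  -- Since [t, 1 - e] = [e, t], this choice subtracts ad_e² w, the off-diagonal part of w.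
  refine ⟨adLeft e w, ?_⟩
  have h1 : w - (adLeft e w * (1 - e) - (1 - e) * adLeft e w) = w - adLeft e (adLeft e w) := by
    simp only [adLeft]; noncomm_ring
  rw [h1]
  refine H.central_of_commute ?_ ?_
  · rw [← sub_eq_zero]
    have : adLeft e (w - adLeft e (adLeft e w)) = 0 := by
      rw [adLeft_sub, adLeft_cube H.idem, sub_self]
    exact this
  · intro x hx hx'
    have hit : ∀ k, (adLeft e)^[k] x = x := fun k =>
      Function.iterate_fixed (adLeft_of_upper hx hx') k
    -- Each entry 1 - e contributes the same term to the eBf-component. At k = m + 1 = n - 1 the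
    -- left side is eφ(x)(1 - e), so n - 1 copies of that term sum to zero.
    have hT : ∀ k : ℕ, e * lieSum φ (k + 1) (padTuple (1 - e) x k) * (1 - e) =
        e * φ x * (1 - e) + k • (x * w * (1 - e) - e * w * x) := by
      intro k
      induction k with
      | zero => rw [lieSum_padTuple_zero]; simp
      | succ k ih =>
        rw [lieSum_padTuple_succ, hit, ← hw, add_smul, one_smul, ← add_assoc, ← ih]
        set T := lieSum φ (k + 1) (padTuple (1 - e) x k)
        have e1 : ∀ t, e * (x * t) = x * t := fun t => by rw [← mul_assoc, hx]
        simp only [adLeft, mul_add, add_mul, mul_sub, sub_mul, mul_one, mul_assoc, he', e1, H.idem,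
          hx', mul_zero]
        abel
    have h2 := hT (m + 1)
    rw [← hφ, lieP_padTuple, hit, left_eq_add] at h2
    have h3 := htf _ h2
    have e1 : ∀ t, x * (e * t) = 0 := fun t => by rw [← mul_assoc, hx', zero_mul]
    simp only [adLeft, mul_sub, sub_mul, mul_one, mul_assoc, he', e1, hx, H.idem] at h3 ⊢
    refine sub_eq_zero.1 (neg_eq_zero.1 (Eq.trans ?_ h3))
    abel

end IsLinkedIdempotent

/-! ### Action on the Peirce components -/

/-- An additive map preserving the Peirce decomposition of `e`, with the Leibniz rule for Lie
brackets with an off-diagonal element. -/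
structure IsPeirceLie {B : Type*} [Ring B] (e : B) (φ : B →+ B) : Prop where
  upper : ∀ x, e * x = x → x * e = 0 → e * φ x = φ x ∧ φ x * e = 0
  lower : ∀ x, e * x = 0 → x * e = x → e * φ x = 0 ∧ φ x * e = φ x
  diag : ∀ x, e * x = x * e → e * φ x = φ x * e
  bracket_upper : ∀ x y, e * x = x → x * e = 0 →
    φ (x * y - y * x) = (φ x * y - y * φ x) + (x * φ y - φ y * x)
  bracket_lower : ∀ x y, e * x = 0 → x * e = x →
    φ (x * y - y * x) = (φ x * y - y * φ x) + (x * φ y - φ y * x)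

namespace IsLinkedIdempotent

variable {B : Type*} [Ring B] {e u v : B}

theorem isPeirceLie (H : IsLinkedIdempotent e u v)
    (h2 : ∀ x : B, 2 • x = 0 → x = 0) (φ : B →+ B) (m : ℕ)
    (hφ : ∀ x, φ (lieP (m + 2) x) = lieSum φ (m + 2) x)
    (hc : ∀ y, y * φ (1 - e) = φ (1 - e) * y) : IsPeirceLie e φ := by
  obtain ⟨hP, hbr⟩ := leibniz_adLeft H.idem H.left_u H.right_u H.left_v H.right_v H.mul_uv h2 φ m
    hφ hc
  have he' : ∀ t, e * (e * t) = e * t := fun t => by rw [← mul_assoc, H.idem]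
  refine ⟨?_, ?_, ?_, ?_, ?_⟩
  · intro x hx hx'
    have h := hP x
    rw [adLeft_of_upper hx hx', adLeft] at h
    have h1 : e * (φ x * e) = 0 := by
      have h3 := congrArg (e * ·) h
      simp only [mul_sub, he'] at h3
      rwa [eq_comm, sub_eq_self] at h3
    have h3 : φ x * e = 0 := by
      apply h2
      have h4 := congrArg (· * e) h
      simp only [sub_mul, mul_assoc, H.idem, h1, zero_sub] at h4
      rw [two_nsmul]
      nth_rewrite 1 [h4]
      rw [neg_add_cancel]
    refine ⟨?_, h3⟩
    rw [h3, sub_zero] at h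
    exact h.symm
  · intro x hx hx'
    have h := hP x
    rw [adLeft_of_lower hx hx', adLeft, map_neg] at h
    have h1 : e * (φ x * e) = 0 := by
      have h3 := congrArg (· * e) h
      simp only [sub_mul, mul_assoc, H.idem, neg_mul] at h3
      rwa [eq_comm, sub_eq_neg_self] at h3
    have h3 : e * φ x = 0 := by
      apply h2
      have h4 := congrArg (e * ·) h
      simp only [mul_sub, he', h1, sub_zero, mul_neg] at h4
      rw [two_nsmul]
      nth_rewrite 1 [← h4]
      rw [neg_add_cancel]
    refine ⟨h3, ?_⟩
    rw [h3, zero_sub, neg_inj] at h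
    exact h.symm
  · intro x hx
    have h := hP x
    rw [adLeft, adLeft, hx, sub_self, map_zero] at h
    exact sub_eq_zero.1 h.symm
  · intro x y hx hx'
    have h := hbr x y
    rwa [adLeft_of_upper hx hx'] at h
  · intro x y hx hx'
    have h := hbr (-x) y
    have h3 : adLeft e (-x) = x := by simp [adLeft, hx, hx']
    rwa [h3] at h

end IsLinkedIdempotent

namespace IsPeirceLie

variable {B : Type*} [Ring B] {e u v : B} {φ : B →+ B}

/-- As ab = ba = 0, [[x, a], b] = [[x, b], a] for x in eBf. Expanding φ of both sides by the Leibniz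
rule leaves exactly the commutation of x with the defect. -/
theorem defect_central (K : IsPeirceLie e φ) (H : IsLinkedIdempotent e u v) {a b : B}
    (ha : e * a = a) (ha' : a * e = a) (hb : e * b = 0) (hb' : b * e = 0) (y : B) :
    y * ((φ a * b - b * φ a) + (a * φ b - φ b * a)) =
      ((φ a * b - b * φ a) + (a * φ b - φ b * a)) * y := by
  have da := K.diag a (ha.trans ha'.symm)
  have db := K.diag b (hb.trans hb'.symm)
  refine H.central_of_commute ?_ ?_ y
  · have e1 : ∀ t, e * (a * t) = a * t := fun t => by rw [← mul_assoc, ha]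
    have e2 : ∀ t, e * (b * t) = 0 := fun t => by rw [← mul_assoc, hb, zero_mul]
    have e3 : ∀ t, e * (φ a * t) = φ a * (e * t) := fun t => by rw [← mul_assoc, da, mul_assoc]
    have e4 : ∀ t, e * (φ b * t) = φ b * (e * t) := fun t => by rw [← mul_assoc, db, mul_assoc]
    simp only [mul_add, add_mul, mul_sub, sub_mul, mul_assoc, e1, e2, e3, e4, ha, ha', hb, hb',
      ← da, ← db, mul_zero]
    have e5 : ∀ t, a * (e * t) = a * t := fun t => by rw [← mul_assoc, ha']
    have e6 : ∀ t, b * (e * t) = 0 := fun t => by rw [← mul_assoc, hb', zero_mul]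
    simp only [e5, e6]
  · intro x hx hx'
    have hab : a * b = 0 := by rw [← ha', mul_assoc, hb, mul_zero]
    have hba : b * a = 0 := by rw [← ha, ← mul_assoc, hb', zero_mul]
    have e1 : ∀ t, x * (a * t) = 0 := fun t => by
      rw [← ha, ← mul_assoc, ← mul_assoc, hx', zero_mul, zero_mul]
    have hax : e * (x * a - a * x) = x * a - a * x := by
      rw [mul_sub, ← mul_assoc, ← mul_assoc, hx, ha]
    have hax' : (x * a - a * x) * e = 0 := by
      rw [sub_mul, mul_assoc, mul_assoc, hx', ha', ← ha, ← mul_assoc, hx']; simp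
    have hbx : e * (x * b - b * x) = x * b - b * x := by
      rw [mul_sub, ← mul_assoc, ← mul_assoc, hx, hb, zero_mul, ← hx, ← mul_assoc b, hb', zero_mul]
    have hbx' : (x * b - b * x) * e = 0 := by
      rw [sub_mul, mul_assoc, mul_assoc, hx', hb']; simp
    have i1 := K.bracket_upper _ b hax hax'
    have i2 := K.bracket_upper _ a hbx hbx'
    rw [K.bracket_upper x a hx hx'] at i1
    rw [K.bracket_upper x b hx hx'] at i2
    have i3 : (x * a - a * x) * b - b * (x * a - a * x) =
        (x * b - b * x) * a - a * (x * b - b * x) := by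
      simp only [sub_mul, mul_sub, mul_assoc, hab, hba]
      simp only [← mul_assoc, hab, hba]
      simp only [mul_zero, zero_mul]
      abel
    rw [i3, i2] at i1
    rw [← sub_eq_zero] at i1 ⊢
    have e2 : φ x * a * b = 0 := by rw [mul_assoc, hab, mul_zero]
    have e3 : b * a * φ x = 0 := by rw [hba, zero_mul]
    have e4 : φ x * b * a = 0 := by rw [mul_assoc, hba, mul_zero]
    have e5 : a * b * φ x = 0 := by rw [hab, zero_mul]
    rw [← i1]
    simp only [sub_mul, mul_sub, add_mul, mul_add, ← mul_assoc, e2, e3, e4, e5]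
    abel

end IsPeirceLie

/-! ### Extraction of the central part -/

/-- The conditions on the centre of the Peirce corners of `e` used in the decomposition. -/
structure HasCentralCorners {B : Type*} [Ring B] (e : B) : Prop where
  compl : ∀ y, e * y = 0 → y * e = 0 →
    (∀ b, e * b = 0 → b * e = 0 → ∃ z, (∀ t, t * z = z * t) ∧ y * b - b * y = z - e * z) →
    ∃ z, (∀ t, t * z = z * t) ∧ y = z - e * z
  corner : ∀ w, e * w = w → w * e = w → (∀ a, e * a = a → a * e = a → w * a = a * w) →
    ∃ z, (∀ t, t * z = z * t) ∧ w = e * z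

namespace IsPeirceLie

variable {B : Type*} [Ring B] {e u v : B} {φ : B →+ B}

/-- The fBf-part of the central defect is [fφ(a), b], which is the input that `compl` requires. -/
theorem exists_central_of_corner (K : IsPeirceLie e φ) (H : IsLinkedIdempotent e u v)
    (C : HasCentralCorners e) {a : B} (ha : e * a = a) (ha' : a * e = a) :
    ∃ z, (∀ t, t * z = z * t) ∧ φ a - e * φ a = z - e * z := by
  have da := K.diag a (ha.trans ha'.symm)
  apply C.compl
  · rw [mul_sub, ← mul_assoc, H.idem, sub_self]
  · rw [sub_mul, mul_assoc, ← da, ← mul_assoc, H.idem, sub_self]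
  · intro b hb hb'
    have hc := K.defect_central H ha ha' hb hb'
    have db := K.diag b (hb.trans hb'.symm)
    set c := (φ a * b - b * φ a) + (a * φ b - φ b * a) with hcdef
    refine ⟨c, hc, ?_⟩
    have e1 : e * (φ a * b) = 0 := by rw [← mul_assoc, da, mul_assoc, hb, mul_zero]
    have e2 : b * (e * φ a) = 0 := by rw [← mul_assoc, hb', zero_mul]
    have e3 : e * (b * φ a) = 0 := by rw [← mul_assoc, hb, zero_mul]
    have e4 : e * (a * φ b) = a * φ b := by rw [← mul_assoc, ha]
    have e5 : e * (φ b * a) = φ b * a := by rw [← mul_assoc, db, mul_assoc, ha]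
    simp only [hcdef, mul_add, mul_sub, sub_mul, mul_assoc, e1, e2, e3, e4, e5]
    abel

theorem exists_central_of_compl (K : IsPeirceLie e φ) (H : IsLinkedIdempotent e u v)
    (C : HasCentralCorners e) {b : B} (hb : e * b = 0) (hb' : b * e = 0) :
    ∃ z, (∀ t, t * z = z * t) ∧ e * φ b = e * z := by
  have db := K.diag b (hb.trans hb'.symm)
  apply C.corner
  · rw [← mul_assoc, H.idem]
  · rw [mul_assoc, ← db, ← mul_assoc, H.idem]
  · intro a ha ha'
    have hc := K.defect_central H ha ha' hb hb'
    obtain ⟨z, hz, hz'⟩ := K.exists_central_of_corner H C ha ha'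
    have da := K.diag a (ha.trans ha'.symm)
    have h1 : φ a * b - b * φ a = 0 := by
      have e1 : φ a = z - e * z + e * φ a := by rw [← hz', sub_add_cancel]
      have e2 : e * φ a * b = 0 := by rw [da, mul_assoc, hb, mul_zero]
      have e3 : b * (e * φ a) = 0 := by rw [← mul_assoc, hb', zero_mul]
      have e4 : e * z * b = 0 := by rw [hz, mul_assoc, hb, mul_zero]
      have e5 : b * (e * z) = 0 := by rw [← mul_assoc, hb', zero_mul]
      rw [e1, add_mul, mul_add, sub_mul, mul_sub, e2, e3, e4, e5, hz]
      simp
    rw [h1, zero_add] at hc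
    set c := a * φ b - φ b * a with hcdef
    have e4 : e * (a * φ b) = a * φ b := by rw [← mul_assoc, ha]
    have e5 : e * (φ b * a) = φ b * a := by rw [← mul_assoc, db, mul_assoc, ha]
    have hec : e * c = c := by rw [hcdef, mul_sub, e4, e5]
    -- The defect is now central and lies in eBe, so cu = uc = (ue)c = 0, and c = cuv = 0.
    have huc : c * u = 0 := by rw [← hc, ← hec, ← mul_assoc, H.right_u, zero_mul]
    have hc0 : c = 0 := by
      rw [← hec, hc, ← H.mul_uv, ← mul_assoc, huc, zero_mul]
    have h6 : a * (e * φ b) = a * φ b := by rw [← mul_assoc, ha']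
    rw [mul_assoc, e5, h6]
    exact (sub_eq_zero.1 (hcdef ▸ hc0)).symm

/-- The central part of `φ`. -/
theorem exists_central_map (K : IsPeirceLie e φ) (H : IsLinkedIdempotent e u v)
    (C : HasCentralCorners e) (x : B) :
    ∃ z, (∀ t, t * z = z * t) ∧
      e * z = u * φ (e * x * e) * v + e * φ ((1 - e) * x * (1 - e)) := by
  obtain ⟨z, hz, hz'⟩ := K.exists_central_of_corner H C (a := e * x * e)
    (by rw [← mul_assoc, ← mul_assoc, H.idem]) (by rw [mul_assoc, H.idem])
  have c1 : e * (1 - e) = 0 := by rw [mul_sub, H.idem, mul_one, sub_self]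
  have c2 : (1 - e) * e = 0 := by rw [sub_mul, H.idem, one_mul, sub_self]
  obtain ⟨z', hw, hw'⟩ := K.exists_central_of_compl H C (b := (1 - e) * x * (1 - e))
    (by rw [← mul_assoc, ← mul_assoc, c1]; simp) (by rw [mul_assoc, c2, mul_zero])
  refine ⟨z + z', fun t => by rw [mul_add, add_mul, hz, hw], ?_⟩
  rw [mul_add, hw']
  congr 1
  -- The map y ↦ uyv carries fz to ez for central z, moving the wrong-corner component into eBe.
  have h1 : u * (φ (e * x * e) - e * φ (e * x * e)) * v = u * (z - e * z) * v := by rw [hz']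
  simp only [mul_sub, ← mul_assoc, H.right_u, zero_mul, sub_zero] at h1
  rw [h1, hz u, mul_assoc z, H.mul_uv, hz e]

end IsPeirceLie

/-- A splitting of `φ` into a part preserving each Peirce component and a central part. -/
structure IsPeirceSplit {B : Type*} [Ring B] (e : B) (h τ : B →+ B) : Prop where
  central : ∀ x t, t * τ x = τ x * t
  h11 : ∀ x, e * x = x → x * e = x → e * h x = h x ∧ h x * e = h x
  h12 : ∀ x, e * x = x → x * e = 0 → e * h x = h x ∧ h x * e = 0
  h21 : ∀ x, e * x = 0 → x * e = x → e * h x = 0 ∧ h x * e = h x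
  h22 : ∀ x, e * x = 0 → x * e = 0 → e * h x = 0 ∧ h x * e = 0
  τ12 : ∀ x, e * x = x → x * e = 0 → τ x = 0
  τ21 : ∀ x, e * x = 0 → x * e = x → τ x = 0
  bracket_upper : ∀ x y, e * x = x → x * e = 0 →
    h (x * y - y * x) + τ (x * y - y * x) = (h x * y - y * h x) + (x * h y - h y * x)
  bracket_lower : ∀ x y, e * x = 0 → x * e = x →
    h (x * y - y * x) + τ (x * y - y * x) = (h x * y - y * h x) + (x * h y - h y * x)

theorem IsPeirceLie.isPeirceSplit {B : Type*} [Ring B] {e u v : B} {h τ : B →+ B}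
    (K : IsPeirceLie e (h + τ)) (H : IsLinkedIdempotent e u v) (C : HasCentralCorners e)
    (hτ : ∀ x t, t * τ x = τ x * t)
    (hτ' : ∀ x, e * τ x = u * (h + τ) (e * x * e) * v + e * (h + τ) ((1 - e) * x * (1 - e))) :
    IsPeirceSplit e h τ := by
  have off : ∀ x, e * x * e = 0 → (1 - e) * x * (1 - e) = 0 → τ x = 0 := by
    intro x h1 h2
    apply H.eq_zero_of_central (hτ x)
    rw [hτ', h1, h2, map_zero]
    simp
  have t12 : ∀ x, e * x = x → x * e = 0 → τ x = 0 := by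
    intro x hx hx'
    apply off
    · rw [hx, hx']
    · rw [sub_mul, one_mul, hx, sub_self, zero_mul]
  have t21 : ∀ x, e * x = 0 → x * e = x → τ x = 0 := by
    intro x hx hx'
    apply off
    · rw [hx, zero_mul]
    · rw [mul_assoc, mul_sub, mul_one, hx', sub_self, mul_zero]
  have hdef : ∀ x, h x = (h + τ) x - τ x := fun x => by simp
  refine ⟨hτ, ?_, ?_, ?_, ?_, t12, t21, ?_, ?_⟩
  · intro x hx hx'
    have dx := K.diag x (hx.trans hx'.symm)
    obtain ⟨z, hz, hz'⟩ := K.exists_central_of_corner H C hx hx'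
    have hzτ : τ x - z = 0 := by
      apply H.eq_zero_of_central (fun t => by rw [mul_sub, sub_mul, hτ, hz])
      have h1 : u * ((h + τ) x - e * (h + τ) x) * v = u * (z - e * z) * v := by rw [hz']
      simp only [mul_sub, ← mul_assoc, H.right_u, zero_mul, sub_zero] at h1
      have h3 : (1 - e) * x * (1 - e) = 0 := by rw [sub_mul, one_mul, hx, sub_self, zero_mul]
      rw [mul_sub, hτ', hx, hx', h1, h3, map_zero, mul_zero, add_zero, hz, mul_assoc, H.mul_uv, hz,
        sub_self]
    have h1 : e * h x = h x := by
      rw [hdef, mul_sub, sub_eq_zero.1 hzτ, ← sub_eq_zero, ← neg_eq_zero]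
      rw [← sub_eq_zero] at hz'
      rw [← hz']; abel
    refine ⟨h1, ?_⟩
    rw [← h1, hdef, mul_sub, sub_mul, mul_assoc e, ← dx, ← mul_assoc, H.idem, mul_assoc e, ← hτ x e,
      ← mul_assoc, H.idem]
  · intro x hx hx'
    have := K.upper x hx hx'
    rwa [hdef, t12 x hx hx', sub_zero]
  · intro x hx hx'
    have := K.lower x hx hx'
    rwa [hdef, t21 x hx hx', sub_zero]
  · intro x hx hx'
    have dx := K.diag x (hx.trans hx'.symm)
    have h1 : e * h x = 0 := by
      have h3 : (1 - e) * x * (1 - e) = x := by simp only [sub_mul, mul_sub, mul_one, one_mul, hx, hx', sub_zero]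
      rw [hdef, mul_sub, hτ', hx, h3, zero_mul, map_zero]
      simp
    refine ⟨h1, ?_⟩
    rw [← h1, hdef, mul_sub, sub_mul, ← hτ x e, dx]
  · intro x y hx hx'
    have h1 := K.bracket_upper x y hx hx'
    have h2 := t12 x hx hx'
    have h3 := hτ y x
    simp only [AddMonoidHom.add_apply, h2, add_zero, mul_add, add_mul, h3] at h1
    rw [h1]; abel
  · intro x y hx hx'
    have h1 := K.bracket_lower x y hx hx'
    have h2 := t21 x hx hx'
    have h3 := hτ y x
    simp only [AddMonoidHom.add_apply, h2, add_zero, mul_add, add_mul, h3] at h1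
    rw [h1]; abel

theorem peirce_induction {B : Type*} [Ring B] {e : B} (he : e * e = e) {p : B → Prop}
    (add : ∀ x y, p x → p y → p (x + y))
    (h11 : ∀ x, e * x = x → x * e = x → p x) (h12 : ∀ x, e * x = x → x * e = 0 → p x)
    (h21 : ∀ x, e * x = 0 → x * e = x → p x) (h22 : ∀ x, e * x = 0 → x * e = 0 → p x)
    (x : B) : p x := by
  have he' : ∀ t, e * (e * t) = e * t := fun t => by rw [← mul_assoc, he]
  have hx : x = ((e * x * e + (e * x - e * x * e)) + (x * e - e * x * e)) +
      (x - e * x - x * e + e * x * e) := by abel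
  rw [hx]
  refine add _ _ (add _ _ (add _ _ (h11 _ ?_ ?_) (h12 _ ?_ ?_)) (h21 _ ?_ ?_)) (h22 _ ?_ ?_) <;>
    simp only [mul_add, add_mul, mul_sub, sub_mul, mul_assoc, he, he'] <;> abel

/-! ### The non-central part is a derivation -/

namespace IsPeirceSplit

variable {B : Type*} [Ring B] {e u v : B} {h τ : B →+ B}

/-- Here xa = 0, so the bracket is a single product, and it is off-diagonal, where τ vanishes. The
next three lemmas use the same mechanism. -/
theorem mul_11_12 (S : IsPeirceSplit e h τ) {a x : B} (ha : e * a = a) (ha' : a * e = a)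
    (hx : e * x = x) (hx' : x * e = 0) : h (a * x) = h a * x + a * h x := by
  have h1 := S.bracket_upper x a hx hx'
  have e1 : x * a = 0 := by rw [← ha, ← mul_assoc, hx', zero_mul]
  have e2 : x * h a = 0 := by rw [← (S.h11 a ha ha').1, ← mul_assoc, hx', zero_mul]
  have e3 : h x * a = 0 := by rw [← ha, ← mul_assoc, (S.h12 x hx hx').2, zero_mul]
  have e4 : τ (a * x) = 0 := S.τ12 _ (by rw [← mul_assoc, ha]) (by rw [mul_assoc, hx', mul_zero])
  rw [e1, e2, e3, zero_sub, zero_sub, zero_sub, map_neg, map_neg, e4, neg_zero, add_zero] at h1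
  rw [← neg_inj, h1]; abel

theorem mul_12_22 (S : IsPeirceSplit e h τ) {x b : B} (hx : e * x = x) (hx' : x * e = 0)
    (hb : e * b = 0) (hb' : b * e = 0) : h (x * b) = h x * b + x * h b := by
  have h1 := S.bracket_upper x b hx hx'
  have e1 : b * x = 0 := by rw [← hx, ← mul_assoc, hb', zero_mul]
  have e2 : h b * x = 0 := by rw [← hx, ← mul_assoc, (S.h22 b hb hb').2, zero_mul]
  have e3 : b * h x = 0 := by rw [← (S.h12 x hx hx').1, ← mul_assoc, hb', zero_mul]
  have e4 : τ (x * b) = 0 := S.τ12 _ (by rw [← mul_assoc, hx]) (by rw [mul_assoc, hb', mul_zero])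
  rwa [e1, e2, e3, sub_zero, sub_zero, sub_zero, e4, add_zero] at h1

theorem mul_21_11 (S : IsPeirceSplit e h τ) {y a : B} (hy : e * y = 0) (hy' : y * e = y)
    (ha : e * a = a) (ha' : a * e = a) : h (y * a) = h y * a + y * h a := by
  have h1 := S.bracket_lower y a hy hy'
  have e1 : a * y = 0 := by rw [← ha', mul_assoc, hy, mul_zero]
  have e2 : h a * y = 0 := by rw [← (S.h11 a ha ha').2, mul_assoc, hy, mul_zero]
  have e3 : a * h y = 0 := by rw [← ha', mul_assoc, (S.h21 y hy hy').1, mul_zero]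
  have e4 : τ (y * a) = 0 := S.τ21 _ (by rw [← mul_assoc, hy, zero_mul]) (by rw [mul_assoc, ha'])
  rwa [e1, e2, e3, sub_zero, sub_zero, sub_zero, e4, add_zero] at h1

theorem mul_22_21 (S : IsPeirceSplit e h τ) {b y : B} (hb : e * b = 0) (hb' : b * e = 0)
    (hy : e * y = 0) (hy' : y * e = y) : h (b * y) = h b * y + b * h y := by
  have h1 := S.bracket_lower y b hy hy'
  have e1 : y * b = 0 := by rw [← hy', mul_assoc, hb, mul_zero]
  have e2 : y * h b = 0 := by rw [← hy', mul_assoc, (S.h22 b hb hb').1, mul_zero]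
  have e3 : h y * b = 0 := by rw [← (S.h21 y hy hy').2, mul_assoc, hb, mul_zero]
  have e4 : τ (b * y) = 0 := S.τ21 _ (by rw [← mul_assoc, hb, zero_mul]) (by rw [mul_assoc, hy'])
  rw [e1, e2, e3, zero_sub, zero_sub, zero_sub, map_neg, map_neg, e4, neg_zero, add_zero] at h1
  rw [← neg_inj, h1]; abel

/-- Expand h(abu) as h((ab)u) and as h(a(bu)), then cancel `u` by multiplying by `v`. -/
theorem mul_11_11 (S : IsPeirceSplit e h τ) (H : IsLinkedIdempotent e u v) {a b : B}
    (ha : e * a = a) (ha' : a * e = a) (hb : e * b = b) (hb' : b * e = b) :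
    h (a * b) = h a * b + a * h b := by
  have hab : e * (a * b) = a * b := by rw [← mul_assoc, ha]
  have hab' : a * b * e = a * b := by rw [mul_assoc, hb']
  have hbu : e * (b * u) = b * u := by rw [← mul_assoc, hb]
  have hbu' : b * u * e = 0 := by rw [mul_assoc, H.right_u, mul_zero]
  have h1 := S.mul_11_12 hab hab' H.left_u H.right_u
  rw [mul_assoc, S.mul_11_12 ha ha' hbu hbu', S.mul_11_12 hb hb' H.left_u H.right_u, mul_add,
    ← mul_assoc, ← mul_assoc, ← mul_assoc, ← add_assoc, add_left_inj, ← add_mul] at h1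
  have h2 := congrArg (· * v) h1
  simp only [mul_assoc, H.mul_uv] at h2
  rw [(S.h11 _ hab hab').2, add_mul, mul_assoc, mul_assoc, hb', (S.h11 b hb hb').2] at h2
  exact h2.symm

theorem mul_22_22 (S : IsPeirceSplit e h τ) (H : IsLinkedIdempotent e u v) {a b : B}
    (ha : e * a = 0) (ha' : a * e = 0) (hb : e * b = 0) (hb' : b * e = 0) :
    h (a * b) = h a * b + a * h b := by
  have hab : e * (a * b) = 0 := by rw [← mul_assoc, ha, zero_mul]
  have hab' : a * b * e = 0 := by rw [mul_assoc, hb', mul_zero]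
  rw [← sub_eq_zero]
  apply H.faithful
  · rw [mul_sub, mul_add, ← mul_assoc, ← mul_assoc, ha, (S.h22 a ha ha').1, (S.h22 _ hab hab').1]
    simp
  · intro x hx hx'
    have hxa : e * (x * a) = x * a := by rw [← mul_assoc, hx]
    have hxa' : x * a * e = 0 := by rw [mul_assoc, ha', mul_zero]
    have h1 := S.mul_12_22 hx hx' hab hab'
    rw [← mul_assoc, S.mul_12_22 hxa hxa' hb hb', S.mul_12_22 hx hx' ha ha', ← sub_eq_zero] at h1
    rw [← neg_eq_zero]
    refine Eq.trans ?_ h1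
    noncomm_ring

theorem mul_12_21_left (S : IsPeirceSplit e h τ) {x y : B} (hx : e * x = x) (hx' : x * e = 0)
    (hy : e * y = 0) (hy' : y * e = y) :
    h (x * y) + e * τ (x * y - y * x) = h x * y + x * h y := by
  have h1 := congrArg (e * ·) (S.bracket_upper x y hx hx')
  have e1 : e * h (y * x) = 0 := (S.h22 _ (by rw [← mul_assoc, hy, zero_mul])
    (by rw [mul_assoc, hx', mul_zero])).1
  have e2 : e * h (x * y) = h (x * y) := (S.h11 _ (by rw [← mul_assoc, hx])
    (by rw [mul_assoc, hy'])).1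
  have e3 : e * (y * h x) = 0 := by rw [← mul_assoc, hy, zero_mul]
  have e4 : e * (h y * x) = 0 := by rw [← mul_assoc, (S.h21 y hy hy').1, zero_mul]
  have e5 : e * (h x * y) = h x * y := by rw [← mul_assoc, (S.h12 x hx hx').1]
  have e6 : e * (x * h y) = x * h y := by rw [← mul_assoc, hx]
  rw [map_sub h] at h1
  simpa only [mul_add, mul_sub, e1, e2, e3, e4, e5, e6, sub_zero] using h1

theorem mul_12_21_right (S : IsPeirceSplit e h τ) {x y : B} (hx : e * x = x) (hx' : x * e = 0)
    (hy : e * y = 0) (hy' : y * e = y) :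
    h (y * x) = h y * x + y * h x + (τ (x * y - y * x) - e * τ (x * y - y * x)) := by
  have h1 := S.bracket_upper x y hx hx'
  have h2 := S.mul_12_21_left hx hx' hy hy'
  rw [map_sub h, ← eq_sub_iff_add_eq, sub_eq_iff_eq_add] at h1
  rw [h1, ← sub_eq_zero] at h2
  rw [← sub_eq_zero]
  refine Eq.trans ?_ h2
  abel

theorem map_idem (S : IsPeirceSplit e h τ) (H : IsLinkedIdempotent e u v) : h e = 0 := by
  have h1 := S.mul_11_12 H.idem H.idem H.left_u H.right_u
  rw [H.left_u, (S.h12 u H.left_u H.right_u).1, right_eq_add] at h1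
  rw [← (S.h11 e H.idem H.idem).2, ← H.mul_uv, ← mul_assoc, H.mul_uv, h1, zero_mul]

/-- With t = τ([u, v]), h(e) = 0 makes the sum equal to et. Expanding h(u) = h(u·vu) gives u h(vu) v
= 0, which is the sum plus et, so twice the sum is zero. -/
theorem map_bracket_uv (S : IsPeirceSplit e h τ) (H : IsLinkedIdempotent e u v)
    (h2 : ∀ x : B, 2 • x = 0 → x = 0) : h u * v + u * h v = 0 := by
  have hl := S.mul_12_21_left H.left_u H.right_u H.left_v H.right_v
  have hr := S.mul_12_21_right H.left_u H.right_u H.left_v H.right_v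
  set t := τ (u * v - v * u) with ht
  have hc : ∀ s, s * t = t * s := S.central _
  rw [H.mul_uv, S.map_idem H, zero_add] at hl
  have hvu : e * (v * u) = 0 := by rw [← mul_assoc, H.left_v, zero_mul]
  have hvu' : v * u * e = 0 := by rw [mul_assoc, H.right_u, mul_zero]
  have h3 := S.mul_12_22 H.left_u H.right_u hvu hvu'
  have hhu := S.h12 u H.left_u H.right_u
  have hhv := S.h21 v H.left_v H.right_v
  rw [← mul_assoc, H.mul_uv, H.left_u] at h3
  have h4 : u * h (v * u) * v = 0 := by
    have h5 := congrArg (· * v) h3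
    have e1 : h u * (v * u) * v = h u * v := by
      rw [mul_assoc, mul_assoc v, H.mul_uv, H.right_v]
    rwa [add_mul, e1, left_eq_add] at h5
  have e2 : u * (h v * u) * v = u * h v := by
    rw [mul_assoc, mul_assoc, H.mul_uv, hhv.2]
  have e3 : u * (v * h u) * v = h u * v := by
    rw [← mul_assoc, H.mul_uv, hhu.1]
  have e4 : u * t * v = e * t := by rw [hc, mul_assoc, H.mul_uv, hc]
  have e5 : u * (e * t) = 0 := by rw [← mul_assoc, H.right_u, zero_mul]
  rw [hr, mul_add, mul_add, mul_sub, e5, sub_zero, add_mul, add_mul, e2, e3, e4, hl] at h4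
  apply h2
  rw [two_nsmul, ← h4]
  abel

/-- Since y = (yu)v with yu in fBf, the claim follows from the rules already known for x(yu), (xy)u
and (yu)v, combined with h(u)v + u h(v) = 0. -/
theorem mul_12_21 (S : IsPeirceSplit e h τ) (H : IsLinkedIdempotent e u v)
    (h2 : ∀ x : B, 2 • x = 0 → x = 0) {x y : B} (hx : e * x = x) (hx' : x * e = 0)
    (hy : e * y = 0) (hy' : y * e = y) :
    h (x * y) = h x * y + x * h y := by
  have hyu : e * (y * u) = 0 := by rw [← mul_assoc, hy, zero_mul]
  have hyu' : y * u * e = 0 := by rw [mul_assoc, H.right_u, mul_zero]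
  have hxy : e * (x * y) = x * y := by rw [← mul_assoc, hx]
  have hxy' : x * y * e = x * y := by rw [mul_assoc, hy']
  have i1 : h y = h (y * u) * v + y * u * h v := by
    have := S.mul_22_21 hyu hyu' H.left_v H.right_v
    rwa [mul_assoc, H.mul_uv, hy'] at this
  have i2 : h (x * y) * u + x * y * h u = h x * (y * u) + x * h (y * u) := by
    rw [← S.mul_11_12 hxy hxy' H.left_u H.right_u, mul_assoc, S.mul_12_22 hx hx' hyu hyu']
  have i3 := congrArg (· * v) i2
  simp only [add_mul, mul_assoc, H.mul_uv, hy', (S.h11 _ hxy hxy').2] at i3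
  have i4 : u * h v = -(h u * v) := (neg_eq_of_add_eq_zero_right (S.map_bracket_uv H h2)).symm
  rw [i1, mul_assoc, i4, mul_add, ← sub_eq_zero]
  rw [← sub_eq_zero] at i3
  rw [← i3]
  noncomm_ring

theorem mul_21_12 (S : IsPeirceSplit e h τ) (H : IsLinkedIdempotent e u v)
    (h2 : ∀ x : B, 2 • x = 0 → x = 0) {y x : B} (hy : e * y = 0) (hy' : y * e = y)
    (hx : e * x = x) (hx' : x * e = 0) : h (y * x) = h y * x + y * h x := by
  have h1 := S.mul_12_21_left hx hx' hy hy'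
  rw [S.mul_12_21 H h2 hx hx' hy hy', add_eq_left] at h1
  rw [S.mul_12_21_right hx hx' hy hy', H.eq_zero_of_central (S.central _) h1]
  simp

theorem map_mul (S : IsPeirceSplit e h τ) (H : IsLinkedIdempotent e u v)
    (h2 : ∀ x : B, 2 • x = 0 → x = 0) (x y : B) : h (x * y) = h x * y + x * h y := by
  have zl : ∀ {p q : B}, p * e = p → e * q = 0 → p * q = 0 := fun hp hq => by
    rw [← hp, mul_assoc, hq, mul_zero]
  have zr : ∀ {p q : B}, p * e = 0 → e * q = q → p * q = 0 := fun hp hq => by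
    rw [← hq, ← mul_assoc, hp, zero_mul]
  have addl : ∀ y x x', h (x * y) = h x * y + x * h y → h (x' * y) = h x' * y + x' * h y →
      h ((x + x') * y) = h (x + x') * y + (x + x') * h y := by
    intro y x x' h1 h3
    rw [add_mul, map_add, map_add, h1, h3]
    noncomm_ring
  have addr : ∀ x y y', h (x * y) = h x * y + x * h y → h (x * y') = h x * y' + x * h y' →
      h (x * (y + y')) = h x * (y + y') + x * h (y + y') := by
    intro x y y' h1 h3
    rw [mul_add, map_add, map_add, h1, h3]
    noncomm_ring
  have zero : ∀ {x y : B}, x * y = 0 → h x * y = 0 → x * h y = 0 →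
      h (x * y) = h x * y + x * h y := by
    intro x y h1 h3 h4
    rw [h1, h3, h4, map_zero, add_zero]
  induction x using peirce_induction H.idem with
  | add x x' h1 h3 => exact addl _ _ _ h1 h3
  | h11 x hx hx' =>
    have kx := S.h11 x hx hx'
    induction y using peirce_induction H.idem with
    | add y y' h1 h3 => exact addr _ _ _ h1 h3
    | h11 y hy hy' => exact S.mul_11_11 H hx hx' hy hy'
    | h12 y hy hy' => exact S.mul_11_12 hx hx' hy hy'
    | h21 y hy hy' => exact zero (zl hx' hy) (zl kx.2 hy) (zl hx' (S.h21 y hy hy').1)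
    | h22 y hy hy' => exact zero (zl hx' hy) (zl kx.2 hy) (zl hx' (S.h22 y hy hy').1)
  | h12 x hx hx' =>
    have kx := S.h12 x hx hx'
    induction y using peirce_induction H.idem with
    | add y y' h1 h3 => exact addr _ _ _ h1 h3
    | h11 y hy hy' => exact zero (zr hx' hy) (zr kx.2 hy) (zr hx' (S.h11 y hy hy').1)
    | h12 y hy hy' => exact zero (zr hx' hy) (zr kx.2 hy) (zr hx' (S.h12 y hy hy').1)
    | h21 y hy hy' => exact S.mul_12_21 H h2 hx hx' hy hy'
    | h22 y hy hy' => exact S.mul_12_22 hx hx' hy hy'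
  | h21 x hx hx' =>
    have kx := S.h21 x hx hx'
    induction y using peirce_induction H.idem with
    | add y y' h1 h3 => exact addr _ _ _ h1 h3
    | h11 y hy hy' => exact S.mul_21_11 hx hx' hy hy'
    | h12 y hy hy' => exact S.mul_21_12 H h2 hx hx' hy hy'
    | h21 y hy hy' => exact zero (zl hx' hy) (zl kx.2 hy) (zl hx' (S.h21 y hy hy').1)
    | h22 y hy hy' => exact zero (zl hx' hy) (zl kx.2 hy) (zl hx' (S.h22 y hy hy').1)
  | h22 x hx hx' =>
    have kx := S.h22 x hx hx'
    induction y using peirce_induction H.idem with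
    | add y y' h1 h3 => exact addr _ _ _ h1 h3
    | h11 y hy hy' => exact zero (zr hx' hy) (zr kx.2 hy) (zr hx' (S.h11 y hy hy').1)
    | h12 y hy hy' => exact zero (zr hx' hy) (zr kx.2 hy) (zr hx' (S.h12 y hy hy').1)
    | h21 y hy hy' => exact S.mul_22_21 hx hx' hy hy'
    | h22 y hy hy' => exact S.mul_22_22 H hx hx' hy hy'

end IsPeirceSplit

/-! ### Linearity of the central part and the abstract theorem -/

section Standard

variable {R B : Type*} [CommRing R] [Ring B] [Algebra R B]

/-- A central z is determined by ez, so the pointwise choice is unique and inherits linearity. -/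
theorem IsPeirceLie.exists_linearMap {e u v : B} {φ : B →ₗ[R] B}
    (K : IsPeirceLie e φ.toAddMonoidHom) (H : IsLinkedIdempotent e u v)
    (C : HasCentralCorners e) :
    ∃ τ : B →ₗ[R] B, (∀ x t, t * τ x = τ x * t) ∧
      ∀ x, e * τ x = u * φ (e * x * e) * v + e * φ ((1 - e) * x * (1 - e)) := by
  choose τ hτ hτ' using K.exists_central_map H C
  simp only [LinearMap.toAddMonoidHom_coe] at hτ'
  have uniq : ∀ z w, (∀ t, t * z = z * t) → (∀ t, t * w = w * t) → e * z = e * w → z = w := by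
    intro z w hz hw h
    rw [← sub_eq_zero]
    apply H.eq_zero_of_central (fun t => by rw [mul_sub, sub_mul, hz, hw])
    rw [mul_sub, h, sub_self]
  refine ⟨⟨⟨τ, ?_⟩, ?_⟩, hτ, hτ'⟩
  · intro x y
    refine uniq _ _ (hτ _) (fun t => by rw [mul_add, add_mul, hτ, hτ]) ?_
    simp only [hτ', mul_add, add_mul, map_add]
    abel
  · intro r x
    refine uniq _ _ (hτ _) (fun t => by simp [hτ]) ?_
    simp only [hτ', mul_smul_comm, smul_mul_assoc, map_smul, smul_add, RingHom.id_apply]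

theorem IsLieNDerivation.map_lieP_eq_lieSum {n : ℕ} {φ : B →ₗ[R] B} (hφ : IsLieNDerivation n φ)
    (x : Fin n → B) : φ (lieP n x) = lieSum φ n x := hφ x

theorem isStandard_of_derivation_add_central {n : ℕ} {φ h τ : B →ₗ[R] B}
    (hφ : IsLieNDerivation (n + 2) φ) (hadd : φ = h + τ) (hh : IsAlgDerivation h)
    (hτ : ∀ x t, t * τ x = τ x * t) : IsStandard (n + 2) φ := by
  refine ⟨h, τ, hadd, hh, fun x => Subalgebra.mem_center_iff.2 (hτ x), fun x => ?_⟩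
  have h1 := hφ.map_lieP_eq_lieSum x
  have h2 := lieSum_eq_of_derivation h hh (map_sub h) (n + 1) x
  have h3 : lieSum τ (n + 2) x = 0 :=
    Finset.sum_eq_zero fun i _ => lieP_eq_zero_of_central (hτ (x i)) n x i
  have h4 : lieSum φ (n + 2) x = lieSum h (n + 2) x + lieSum τ (n + 2) x := by
    rw [← lieSum_add, hadd]
    rfl
  rwa [h4, h3, add_zero, ← h2, hadd, LinearMap.add_apply, add_eq_left] at h1

/-- Every Lie `n`-derivation of an algebra with a linked idempotent with central corners is
standard. -/
theorem isStandard_of_isLinkedIdempotent {e u v : B} (H : IsLinkedIdempotent e u v)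
    (C : HasCentralCorners e) {n : ℕ} (hn : 2 ≤ n) (h2 : IsNTorsionFree 2 B)
    (htf : IsNTorsionFree (n - 1) B) {φ : B →ₗ[R] B} (hφ : IsLieNDerivation n φ) :
    IsStandard n φ := by
  obtain ⟨m, rfl⟩ := Nat.exists_eq_add_of_le' hn
  obtain ⟨t, ht⟩ := H.exists_adLeft_central m htf φ.toAddMonoidHom hφ
  set δ : B →ₗ[R] B := LinearMap.mulLeft R t - LinearMap.mulRight R t with hδ
  have hδ' : ∀ x, δ x = t * x - x * t := fun x => by simp [hδ]
  have δder : IsAlgDerivation δ := fun x y => by simp only [hδ']; noncomm_ring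
  have hψ : ∀ x, (φ - δ).toAddMonoidHom (lieP (m + 2) x) =
      lieSum (φ - δ).toAddMonoidHom (m + 2) x := by
    intro x
    have h1 : lieSum φ (m + 2) x =
        lieSum (φ - δ).toAddMonoidHom (m + 2) x + lieSum δ (m + 2) x := by
      rw [← lieSum_add]
      congr 1
      funext y
      simp
    rw [← lieSum_eq_of_derivation δ δder (map_sub δ), ← hφ.map_lieP_eq_lieSum] at h1
    simp [h1]
  have K : IsPeirceLie e (φ - δ).toAddMonoidHom :=
    H.isPeirceLie h2 _ m hψ (by simpa [hδ'] using ht)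
  obtain ⟨τ, hτ, hτ'⟩ := K.exists_linearMap H C
  have hsum : (φ - δ - τ).toAddMonoidHom + τ.toAddMonoidHom = (φ - δ).toAddMonoidHom := by
    ext x; simp
  have S : IsPeirceSplit e (φ - δ - τ).toAddMonoidHom τ.toAddMonoidHom :=
    IsPeirceLie.isPeirceSplit (by rwa [hsum]) H C hτ (by rw [hsum]; exact hτ')
  refine isStandard_of_derivation_add_central (h := φ - δ - τ + δ) (τ := τ) hφ (by abel) ?_ hτ
  intro x y
  have h3 : (φ - δ - τ) (x * y) = (φ - δ - τ) x * y + x * (φ - δ - τ) y := S.map_mul H h2 x y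
  rw [LinearMap.add_apply, LinearMap.add_apply, LinearMap.add_apply, h3, δder]
  noncomm_ring

end Standard

/-! ### Matrix algebras -/

section Matrices

open Matrix

variable {A : Type*} [Ring A] {s : ℕ}

theorem isLinkedIdempotent_single :
    IsLinkedIdempotent (single 0 0 1 : Matrix (Fin (s + 2)) (Fin (s + 2)) A) (single 0 1 1)
      (single 1 0 1) where
  idem := by simp
  left_u := by simp
  right_u := by simp
  left_v := by simp
  right_v := by simp
  mul_uv := by simp
  faithful b hb hx := by
    ext i j
    by_cases hi : i = 0
    · have := congrFun (congrFun hb 0) j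
      simpa [hi] using this
    -- Multiplying by E₀ᵢ moves row i of b to row 0.
    · have := congrFun (congrFun (hx (single 0 i 1) (by simp) (by simp [hi])) 0) j
      simpa using this

theorem exists_central_scalar {c : A} (hc : ∀ a, a * c = c * a) :
    ∃ z : Matrix (Fin s) (Fin s) A, (∀ t, t * z = z * t) ∧ z = diagonal fun _ => c := by
  refine ⟨_, fun t => ?_, rfl⟩
  ext i j
  simp [hc]

theorem central_apply_of_ne {z : Matrix (Fin s) (Fin s) A} (hz : ∀ t, t * z = z * t)
    {i j : Fin s} (hij : i ≠ j) : z i j = 0 := by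
  have := congrFun (congrFun (hz (single i i 1)) i) j
  simpa [hij.symm, hij] using this

theorem central_apply_self {z : Matrix (Fin s) (Fin s) A} (hz : ∀ t, t * z = z * t)
    (i j : Fin s) (a : A) : a * z j j = z i i * a := by
  have := congrFun (congrFun (hz (single i j a)) i) j
  simpa using this

/-- Testing y against the matrix units of fBf makes it a scalar y₁₁ there, since central matrices
are diagonal. Testing against cE₁₁ (indices from 0) gives [y₁₁, c] in place (1, 1): a third index
forces it to vanish, while in size 2 it is only known to be central in `A`, hence the second
alternative. -/
theorem hasCentralCorners_single
    (hA : 1 ≤ s ∨ ∀ y : A, (∀ c d, d * (y * c - c * y) = (y * c - c * y) * d) → ∀ c, c * y = y * c) :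
    HasCentralCorners (single 0 0 1 : Matrix (Fin (s + 2)) (Fin (s + 2)) A) where
  corner w hw hw' hc := by
    obtain ⟨z, hz, hz'⟩ := exists_central_scalar (s := s + 2) (c := w 0 0) (fun a => by
      have := congrFun (congrFun (hc (single 0 0 a) (by simp) (by simp)) 0) 0
      simpa using this.symm)
    refine ⟨z, hz, ?_⟩
    rw [← hw, ← hw', hz']
    ext i j
    by_cases hi : i = 0 <;> by_cases hj : j = 0 <;>
      simp [hi, hj, single_apply, diagonal_apply, Matrix.mul_apply, eq_comm]
  compl y hy hy' hb := by
    have row : ∀ j, y 0 j = 0 := fun j => by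
      simpa using congrFun (congrFun hy 0) j
    have col : ∀ i, y i 0 = 0 := fun i => by
      simpa using congrFun (congrFun hy' i) 0
    have off : ∀ i j, i ≠ j → y i j = 0 := by
      intro i j hij
      by_cases hj : j = 0
      · rw [hj, col]
      obtain ⟨z, hz, hz'⟩ := hb (single j j 1) (by simp [Ne.symm hj]) (by simp [hj])
      have := congrFun (congrFun hz' i) j
      by_cases hi : i = 0
      · rw [hi, row]
      simpa [hij, hi, central_apply_of_ne hz hij] using this
    have diag : ∀ i j, i ≠ 0 → j ≠ 0 → y i i = y j j := by
      intro i j hi hj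
      by_cases hij : i = j
      · rw [hij]
      obtain ⟨z, hz, hz'⟩ := hb (single i j 1) (by simp [Ne.symm hi]) (by simp [hj])
      have := congrFun (congrFun hz' i) j
      simp [central_apply_of_ne hz hij, hi] at this
      exact sub_eq_zero.1 this
    have comm : ∀ c, c * y 1 1 = y 1 1 * c := by
      have h1 : ∀ c, ∃ z : Matrix (Fin (s + 2)) (Fin (s + 2)) A, (∀ t, t * z = z * t) ∧
          y * single 1 1 c - single 1 1 c * y = z - single 0 0 1 * z := fun c =>
        hb (single 1 1 c) (by simp) (by simp)
      rcases hA with hs | hA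
      · intro c
        obtain ⟨z, hz, hz'⟩ := h1 c
        -- The (k, k) entry of the commutator is 0, and a central matrix has equal diagonal entries.
        obtain ⟨k, hk0, hk1⟩ : ∃ k : Fin (s + 2), k ≠ 0 ∧ k ≠ 1 :=
          ⟨⟨2, by omega⟩, by simp [Fin.ext_iff], by simp [Fin.ext_iff]⟩
        have e1 := congrFun (congrFun hz' 1) 1
        have e2 := congrFun (congrFun hz' k) k
        have e3 := central_apply_self hz 1 k 1
        simp [hk0, hk1] at e1 e2 e3
        rw [← e3, ← e2] at e1
        exact (sub_eq_zero.1 e1).symm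
      · apply hA
        intro c d
        obtain ⟨z, hz, hz'⟩ := h1 c
        have e1 := congrFun (congrFun hz' 1) 1
        simp at e1
        rw [e1]
        exact central_apply_self hz 1 1 d
    obtain ⟨z, hz, hz'⟩ := exists_central_scalar (s := s + 2) comm
    refine ⟨z, hz, ?_⟩
    rw [hz']
    ext i j
    by_cases hi : i = 0
    · subst hi
      rw [row]
      by_cases hj : j = 0
      · simp [hj]
      · simp [Ne.symm hj]
    · by_cases hij : i = j
      · subst hij
        simp [Ne.symm hi, diag i 1 hi (by simp)]
      · simp [hij, off i j hij, Ne.symm hi]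

theorem central_of_commutator_central (hA : (∀ a b : A, a * b = b * a) ∨ IsPrimeAlg A) (y : A)
    (hy : ∀ c d, d * (y * c - c * y) = (y * c - c * y) * d) (c : A) : c * y = y * c := by
  rcases hA with hA | ⟨-, hA⟩
  · exact hA c y
  · set t := y * c - c * y with ht
    -- As [y, yc] = yt commutes with c and t is central, [y, c]t = t² = 0. Then tAt = At² = 0, and
    -- primeness gives t = 0.
    have h1 := hy (y * c) c
    have h2 : y * (y * c) - y * c * y = y * t := by rw [ht]; noncomm_ring
    have h3 : t * t = 0 := by
      have h4 : y * t * c = y * c * t := by rw [mul_assoc, ← hy c c, mul_assoc]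
      rw [h2, h4] at h1
      nth_rewrite 1 [ht]
      rw [sub_mul, mul_assoc c, h1, sub_self]
    have h4 : t = 0 := by
      have := hA t t fun x => by rw [← hy c x, mul_assoc, h3, mul_zero]
      tauto
    exact (sub_eq_zero.1 h4).symm

end Matrices

theorem mainTheorem8 {R A : Type*} [CommRing R] [Ring A] [Algebra R A] (n : ℕ) (hn : 2 ≤ n) :
    (∀ s : ℕ, 3 ≤ s →
      IsNTorsionFree 2 (Matrix (Fin s) (Fin s) A) →
      IsNTorsionFree (n - 1) (Matrix (Fin s) (Fin s) A) →
      ∀ φ : Matrix (Fin s) (Fin s) A →ₗ[R] Matrix (Fin s) (Fin s) A,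
        IsLieNDerivation n φ → IsStandard n φ) ∧
    (IsNTorsionFree 2 (Matrix (Fin 2) (Fin 2) A) →
      IsNTorsionFree (n - 1) (Matrix (Fin 2) (Fin 2) A) →
      ((∀ a b : A, a * b = b * a) ∨ (¬ (∀ a b : A, a * b = b * a) ∧ IsPrimeAlg A)) →
      ∀ φ : Matrix (Fin 2) (Fin 2) A →ₗ[R] Matrix (Fin 2) (Fin 2) A,
        IsLieNDerivation n φ → IsStandard n φ) := by
  refine ⟨fun s hs h2 htf φ hφ => ?_, fun h2 htf hA φ hφ => ?_⟩
  · obtain ⟨s, rfl⟩ := Nat.exists_eq_add_of_le' (Nat.le_of_succ_le hs)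
    exact isStandard_of_isLinkedIdempotent isLinkedIdempotent_single
      (hasCentralCorners_single (Or.inl (by omega))) hn h2 htf hφ
  · exact isStandard_of_isLinkedIdempotent (isLinkedIdempotent_single (s := 0))
      (hasCentralCorners_single (Or.inr (central_of_commutator_central (hA.imp_right And.right))))
      hn h2 htf hφ
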